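/- Let $G$ be a finite group. A tuple $T=(g_1,\dots,g_r)$ of non-trivial elements of $G$ is a spherical system of generators of $G$ if $\langle g_1,\dots,g_r\rangle=G$ and $g_1g_2\cdots g_r=1$. Put $\Sigma(T)=\bigcup_{g\in G}\bigcup_{i=1}^{r}\langle g_i\rangle^{g}$, the union of all conjugates of the cyclic subgroups generated by the entries of $T$. A ramification structure of size $(r_1,r_2)$ for $G$ is a pair $(T_1,T_2)$ of spherical systems of generators of $G$, of lengths $r_1$ and $r_2$, such that $\Sigma(T_1)\cap\Sigma(T_2)=\{1\}$. Proposition. Let $p\ge 5$ be a prime. Then there exists a finite $p$-group $G$, of exponent $p^e$ with $e\ge 1$, such that: (i) $|\{g^{p^{e-1}} \mid g\in G\}|=p$; (ii) $G$ admits a ramification structure of size $(r_1,r_2)$ for all integers $r_1,r_2\ge 3$. -/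

import Mathlib

/-- A tuple `T = (g₁, …, g_r)` of non-trivial elements of `G` is a spherical system of generators
if it generates `G` and `g₁ g₂ ⋯ g_r = 1` (product taken in this order). -/
structure IsSphericalSystem {G : Type*} [Group G] {r : ℕ} (T : Fin r → G) : Prop where
  ne_one : ∀ i, T i ≠ 1
  closure_eq_top : Subgroup.closure (Set.range T) = ⊤
  prod_eq_one : (List.ofFn T).prod = 1

/-- `Σ(T)`: the union of all conjugates `g⁻¹ ⟨gᵢ⟩ g` of the cyclic subgroups generated by the
entries of the tuple `T`. -/
def sphericalSigma {G : Type*} [Group G] {r : ℕ} (T : Fin r → G) : Set G :=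
  ⋃ (g : G) (i : Fin r),
    (((Subgroup.zpowers (T i)).map (MulAut.conj g⁻¹).toMonoidHom : Subgroup G) : Set G)

/-- `(T₁, T₂)` is an (unmixed) ramification structure of size `(r₁, r₂)` for `G`: both tuples are
spherical systems of generators, and they are disjoint, i.e. `Σ(T₁) ∩ Σ(T₂) = 1`. -/
structure IsRamificationStructure {G : Type*} [Group G] {r₁ r₂ : ℕ}
    (T₁ : Fin r₁ → G) (T₂ : Fin r₂ → G) : Prop where
  left : IsSphericalSystem T₁
  right : IsSphericalSystem T₂
  disjoint : sphericalSigma T₁ ∩ sphericalSigma T₂ = {1}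

/-- `S(G)`: the set of all sizes `(r₁, r₂)` of ramification structures of `G`. -/
def ramificationSizes (G : Type*) [Group G] : Set (ℕ × ℕ) :=
  {r | ∃ (T₁ : Fin r.1 → G) (T₂ : Fin r.2 → G), IsRamificationStructure T₁ T₂}

/-! Let `G` be generated by the unitriangular `(p + 1) × (p + 1)` matrices `x` and `y` over `𝔽_p`
with superdiagonals `(1, 0, 1, 1, …)` and `(0, 1, -1, 0, …)`. Since `A ^ p - 1 = (A - 1) ^ p`, the
only entry of `A ^ p - 1` that can be nonzero is the upper right corner, which is the product of
the superdiagonal of `A`. Hence there are at most `p` different `p`-th powers in `G`, the elements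
`x`, `y` and `x * y` have order `p`, and `x * (x * y)` has order `p ^ 2`.

Reading off superdiagonals maps `G` to an elementary abelian group in which the images of `x` and
`y` are independent, and which identifies conjugate elements. For `p ≥ 5` the lines spanned by
`x`, `y` and `x * y` differ from those spanned by `x * y⁻¹`, `x * y ^ 2` and their product. As the
elements of the first triple have order `p`, their cyclic subgroups embed in the quotient, so no
nontrivial element of them is conjugate to a power of an element of the second triple. Finally,
inserting pairs `g, g⁻¹` into spherical systems built from the generators `x, y`, respectively
`x * y⁻¹, x * y ^ 2`, produces all lengths from `3` on without new cyclic subgroups. -/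

section Ramification

variable {G : Type*} [Group G]

theorem exists_list_prod_eq_one (x y : G) : ∀ n : ℕ, ∃ l : List G, l.length = n + 3 ∧
    l.prod = 1 ∧ x ∈ l ∧ y ∈ l ∧
      ∀ t ∈ l, ∃ s ∈ ({x, y, x * y} : Set G), Subgroup.zpowers t = Subgroup.zpowers s
  | 0 => ⟨[x, y, (x * y)⁻¹], rfl, by simp, by simp, by simp, by simp [-mul_inv_rev]⟩
  | 1 => ⟨[x, y, y⁻¹, x⁻¹], rfl, by simp, by simp, by simp, by simp⟩
  | n + 2 => by
    obtain ⟨l, hlen, hprod, _, hy, hl⟩ := exists_list_prod_eq_one x y n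
    exact ⟨x :: x⁻¹ :: l, by simp [hlen], by simp [hprod], by simp, by simp [hy],
      by simpa using hl⟩

theorem exists_isSphericalSystem {x y : G} (hxy : Subgroup.closure {x, y} = ⊤)
    (hne : ∀ s ∈ ({x, y, x * y} : Set G), s ≠ 1) {r : ℕ} (hr : 3 ≤ r) :
    ∃ T : Fin r → G, IsSphericalSystem T ∧
      ∀ i, ∃ s ∈ ({x, y, x * y} : Set G), Subgroup.zpowers (T i) = Subgroup.zpowers s := by
  obtain ⟨n, rfl⟩ := Nat.exists_eq_add_of_le' hr
  obtain ⟨l, hlen, hprod, hx, hy, hl⟩ := exists_list_prod_eq_one x y n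
  rw [← hlen]
  refine ⟨l.get, ⟨fun i => ?_, ?_, by rw [List.ofFn_get, hprod]⟩, fun i => hl _ (l.get_mem i)⟩
  · obtain ⟨s, hs, hzpowers⟩ := hl _ (l.get_mem i)
    rw [ne_eq, ← Subgroup.zpowers_eq_bot, hzpowers, Subgroup.zpowers_eq_bot]
    exact hne s hs
  · rw [eq_top_iff, ← hxy]
    exact Subgroup.closure_mono
      (Set.pair_subset (List.mem_iff_get.1 hx) (List.mem_iff_get.1 hy))

theorem mem_sphericalSigma_iff {r : ℕ} {T : Fin r → G} {z : G} :
    z ∈ sphericalSigma T ↔ ∃ i, ∃ w ∈ Subgroup.zpowers (T i), IsConj w z := by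
  simp only [sphericalSigma, Set.mem_iUnion, SetLike.mem_coe, Subgroup.mem_map, isConj_iff]
  constructor
  · rintro ⟨g, i, w, hw, rfl⟩
    exact ⟨i, w, hw, g⁻¹, by simp⟩
  · rintro ⟨i, w, hw, g, rfl⟩
    exact ⟨g⁻¹, i, w, hw, by simp⟩

theorem one_mem_sphericalSigma {r : ℕ} (hr : 0 < r) (T : Fin r → G) : 1 ∈ sphericalSigma T :=
  mem_sphericalSigma_iff.2 ⟨⟨0, hr⟩, 1, Subgroup.one_mem _, IsConj.refl 1⟩

theorem eq_one_of_isConj_of_disjoint_zpowers {A : Type*} [CommGroup A] (φ : G →* A)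
    {s t a b z : G} (hs : orderOf (φ s) = orderOf s)
    (hst : Disjoint (Subgroup.zpowers (φ s)) (Subgroup.zpowers (φ t)))
    (ha : a ∈ Subgroup.zpowers s) (hb : b ∈ Subgroup.zpowers t)
    (haz : IsConj a z) (hbz : IsConj b z) : z = 1 := by
  have hφ : φ a = φ b := isConj_iff_eq.1 (φ.map_isConj (haz.trans hbz.symm))
  obtain ⟨k, rfl⟩ := ha
  obtain ⟨m, rfl⟩ := hb
  have hφ_one : φ s ^ k = 1 := by
    rw [← Subgroup.mem_bot, ← hst.eq_bot]
    refine ⟨⟨k, rfl⟩, m, ?_⟩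
    simpa only [map_zpow] using hφ.symm
  have hsk : s ^ k = 1 := by
    rwa [← orderOf_dvd_iff_zpow_eq_one, ← hs, orderOf_dvd_iff_zpow_eq_one]
  exact isConj_one_right.1 (hsk ▸ haz)

/-- Conjugation is invisible in a commutative quotient, so disjointness can be tested there. -/
theorem mem_ramificationSizes_of_disjoint_zpowers {A : Type*} [CommGroup A] (φ : G →* A)
    {x₁ y₁ x₂ y₂ : G} (hgen₁ : Subgroup.closure {x₁, y₁} = ⊤)
    (hgen₂ : Subgroup.closure {x₂, y₂} = ⊤)
    (hne₁ : ∀ s ∈ ({x₁, y₁, x₁ * y₁} : Set G), s ≠ 1)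
    (hne₂ : ∀ t ∈ ({x₂, y₂, x₂ * y₂} : Set G), t ≠ 1)
    (hord : ∀ s ∈ ({x₁, y₁, x₁ * y₁} : Set G), orderOf (φ s) = orderOf s)
    (hdisj : ∀ s ∈ ({x₁, y₁, x₁ * y₁} : Set G), ∀ t ∈ ({x₂, y₂, x₂ * y₂} : Set G),
      Disjoint (Subgroup.zpowers (φ s)) (Subgroup.zpowers (φ t)))
    {r₁ r₂ : ℕ} (hr₁ : 3 ≤ r₁) (hr₂ : 3 ≤ r₂) : (r₁, r₂) ∈ ramificationSizes G := by
  obtain ⟨T₁, hT₁, hzpowers₁⟩ := exists_isSphericalSystem hgen₁ hne₁ hr₁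
  obtain ⟨T₂, hT₂, hzpowers₂⟩ := exists_isSphericalSystem hgen₂ hne₂ hr₂
  refine ⟨T₁, T₂, hT₁, hT₂, Set.Subset.antisymm ?_ (Set.singleton_subset_iff.2
    ⟨one_mem_sphericalSigma (by omega) T₁, one_mem_sphericalSigma (by omega) T₂⟩)⟩
  rintro z ⟨hz₁, hz₂⟩
  obtain ⟨i, a, ha, haz⟩ := mem_sphericalSigma_iff.1 hz₁
  obtain ⟨j, b, hb, hbz⟩ := mem_sphericalSigma_iff.1 hz₂
  obtain ⟨s, hs, hsi⟩ := hzpowers₁ i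
  obtain ⟨t, ht, htj⟩ := hzpowers₂ j
  exact eq_one_of_isConj_of_disjoint_zpowers φ (hord s hs) (hdisj s hs t ht)
    (hsi ▸ ha) (htj ▸ hb) haz hbz

theorem disjoint_zpowers_of_linearIndependent {K V : Type*} [Ring K] [AddCommGroup V]
    [Module K V] {v w : Multiplicative V} (hvw : LinearIndependent K ![v.toAdd, w.toAdd]) :
    Disjoint (Subgroup.zpowers v) (Subgroup.zpowers w) := by
  rw [Subgroup.disjoint_def]
  rintro _ ⟨k, rfl⟩ ⟨m, hm⟩
  have heq : m • w.toAdd = k • v.toAdd := congrArg Multiplicative.toAdd hm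
  have hk : (k : K) = 0 := And.left <| LinearIndependent.pair_iff.1 hvw k (-m) <| by
    rw [neg_smul, Int.cast_smul_eq_zsmul, Int.cast_smul_eq_zsmul, heq, add_neg_cancel]
  change Multiplicative.ofAdd (k • v.toAdd) = 1
  rw [← Int.cast_smul_eq_zsmul K, hk, zero_smul, ofAdd_zero]

/-- In the basis `φ x, φ y` the elements of the two triples span the lines `(1 : 0)`, `(0 : 1)`,
`(1 : 1)` and `(1 : -1)`, `(1 : 2)`, `(2 : 1)`; all determinants across are `±1` or `±2`. -/
theorem linearIndependent_map_of_mem_triples {K V : Type*} [CommRing K] [IsDomain K]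
    [AddCommGroup V] [Module K V] (h2 : (2 : K) ≠ 0) {x y : G} (φ : G →* Multiplicative V)
    (hφ : LinearIndependent K ![(φ x).toAdd, (φ y).toAdd]) {s t : G}
    (hs : s ∈ ({x, y, x * y} : Set G))
    (ht : t ∈ ({x * y⁻¹, x * y ^ 2, x * y⁻¹ * (x * y ^ 2)} : Set G)) :
    LinearIndependent K ![(φ s).toAdd, (φ t).toAdd] := by
  have hs_coord : ∃ a b : K, (φ s).toAdd = a • (φ x).toAdd + b • (φ y).toAdd ∧
      ((a, b) = (1, 0) ∨ (a, b) = (0, 1) ∨ (a, b) = (1, 1)) := by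
    rcases hs with rfl | rfl | rfl
    · exact ⟨1, 0, by simp, by simp⟩
    · exact ⟨0, 1, by simp, by simp⟩
    · exact ⟨1, 1, by simp, by simp⟩
  have ht_coord : ∃ c d : K, (φ t).toAdd = c • (φ x).toAdd + d • (φ y).toAdd ∧
      ((c, d) = (1, -1) ∨ (c, d) = (1, 2) ∨ (c, d) = (2, 1)) := by
    rcases ht with rfl | rfl | rfl <;> rw [map_mul, toAdd_mul]
    · exact ⟨1, -1, by simp, by simp⟩
    · exact ⟨1, 2, by simp [ofNat_smul_eq_nsmul], by simp⟩
    · refine ⟨2, 1, ?_, by simp⟩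
      simp only [map_mul, map_inv, map_pow, toAdd_mul, toAdd_inv, toAdd_pow]
      module
  obtain ⟨a, b, hs_eq, hab⟩ := hs_coord
  obtain ⟨c, d, ht_eq, hcd⟩ := ht_coord
  rw [hs_eq, ht_eq]
  exact (LinearIndependent.pair_add_smul_add_smul_iff a b c d).2 ⟨hφ, by grind⟩

theorem closure_mul_inv_mul_sq (x : G) {y : G} (hy : (orderOf y).Coprime 3) :
    Subgroup.closure {x * y⁻¹, x * y ^ 2} = Subgroup.closure {x, y} := by
  set H := Subgroup.closure {x * y⁻¹, x * y ^ 2}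
  have hu : x * y⁻¹ ∈ H := Subgroup.subset_closure (by simp)
  have hv : x * y ^ 2 ∈ H := Subgroup.subset_closure (by simp)
  have hyH : y ∈ H := by
    obtain ⟨m, hm⟩ := exists_pow_eq_self_of_coprime hy.symm
    rw [← hm, show y ^ 3 = (x * y⁻¹)⁻¹ * (x * y ^ 2) by group]
    exact H.pow_mem (H.mul_mem (H.inv_mem hu) hv) m
  have hxH : x ∈ H := by simpa using H.mul_mem hu hyH
  refine le_antisymm ((Subgroup.closure_le _).2 (Set.pair_subset ?_ ?_))
    ((Subgroup.closure_le _).2 (Set.pair_subset hxH hyH))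
  · exact mul_mem (Subgroup.subset_closure (by simp))
      (inv_mem (Subgroup.subset_closure (by simp)))
  · exact mul_mem (Subgroup.subset_closure (by simp))
      (pow_mem (Subgroup.subset_closure (by simp)) 2)

theorem orderOf_map_eq_of_pow_prime_eq_one {p : ℕ} [Fact p.Prime] {A : Type*} [Group A]
    (φ : G →* A) {g : G} (hg : g ^ p = 1) (hφg : φ g ≠ 1) : orderOf (φ g) = orderOf g := by
  rw [orderOf_eq_prime hg fun h => hφg (by rw [h, map_one]),
    orderOf_eq_prime (by rw [← map_pow, hg, map_one]) hφg]

theorem mem_ramificationSizes_of_linearIndependent {p : ℕ} [Fact p.Prime] (hp2 : p ≠ 2)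
    (hp3 : p ≠ 3) {V : Type*} [AddCommGroup V] [Module (ZMod p) V] {x y : G}
    (hxy : Subgroup.closure {x, y} = ⊤)
    (hpow : ∀ s ∈ ({x, y, x * y} : Set G), s ^ p = 1) (φ : G →* Multiplicative V)
    (hφ : LinearIndependent (ZMod p) ![(φ x).toAdd, (φ y).toAdd])
    {r₁ r₂ : ℕ} (hr₁ : 3 ≤ r₁) (hr₂ : 3 ≤ r₂) : (r₁, r₂) ∈ ramificationSizes G := by
  have h2 : (2 : ZMod p) ≠ 0 := Ring.two_ne_zero (by rwa [ZMod.ringChar_zmod_n])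
  have hgen : Subgroup.closure {x * y⁻¹, x * y ^ 2} = ⊤ := by
    have hcoprime := (Nat.coprime_primes Fact.out Nat.prime_three).2 hp3
    rw [closure_mul_inv_mul_sq x (hcoprime.coprime_dvd_left
      (orderOf_dvd_of_pow_eq_one (hpow y (by simp)))), hxy]
  have hindep {s t : G} (hs : s ∈ ({x, y, x * y} : Set G))
      (ht : t ∈ ({x * y⁻¹, x * y ^ 2, x * y⁻¹ * (x * y ^ 2)} : Set G)) :=
    linearIndependent_map_of_mem_triples h2 φ hφ hs ht
  have hne₁ : ∀ s ∈ ({x, y, x * y} : Set G), φ s ≠ 1 := fun s hs =>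
    (hindep hs (.inl rfl)).ne_zero 0
  have hne₂ : ∀ t ∈ ({x * y⁻¹, x * y ^ 2, x * y⁻¹ * (x * y ^ 2)} : Set G), φ t ≠ 1 :=
    fun t ht => (hindep (.inl rfl) ht).ne_zero 1
  exact mem_ramificationSizes_of_disjoint_zpowers φ hxy hgen
    (fun s hs => ne_of_apply_ne φ (by simpa only [map_one] using hne₁ s hs))
    (fun t ht => ne_of_apply_ne φ (by simpa only [map_one] using hne₂ t ht))
    (fun s hs => orderOf_map_eq_of_pow_prime_eq_one φ (hpow s hs) (hne₁ s hs))
    (fun s hs t ht => disjoint_zpowers_of_linearIndependent (hindep hs ht)) hr₁ hr₂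

theorem mem_ramificationSizes_closure_pair {p : ℕ} [Fact p.Prime] (hp2 : p ≠ 2)
    (hp3 : p ≠ 3) {V : Type*} [AddCommGroup V] [Module (ZMod p) V] {x y : G}
    (hpow : ∀ s ∈ ({x, y, x * y} : Set G), s ^ p = 1) (φ : G →* Multiplicative V)
    (hφ : LinearIndependent (ZMod p) ![(φ x).toAdd, (φ y).toAdd])
    {r₁ r₂ : ℕ} (hr₁ : 3 ≤ r₁) (hr₂ : 3 ≤ r₂) :
    (r₁, r₂) ∈ ramificationSizes (Subgroup.closure {x, y} : Subgroup G) := by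
  let X : Subgroup.closure {x, y} := ⟨x, Subgroup.subset_closure (by simp)⟩
  let Y : Subgroup.closure {x, y} := ⟨y, Subgroup.subset_closure (by simp)⟩
  have hXY : Subgroup.closure {X, Y} = ⊤ := by
    rw [← Subgroup.closure_closure_coe_preimage]
    congr 1
    ext g
    simp [X, Y, Subtype.ext_iff]
  have hXYpow : ∀ s ∈ ({X, Y, X * Y} : Set (Subgroup.closure {x, y})), s ^ p = 1 := fun s hs =>
    Subtype.ext (hpow s (by simpa [X, Y, Subtype.ext_iff] using hs))
  exact mem_ramificationSizes_of_linearIndependent hp2 hp3 hXY hXYpow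
    (φ.comp (Subgroup.subtype _)) hφ hr₁ hr₂

end Ramification

section PrimePowerExponent

variable {G : Type*} [Group G] {p : ℕ} [Fact p.Prime]

theorem exponent_eq_prime_pow {e : ℕ} (hG : ∀ g : G, g ^ p ^ (e + 1) = 1) {g : G}
    (hg : g ^ p ^ e ≠ 1) : Monoid.exponent G = p ^ (e + 1) :=
  dvd_antisymm (Monoid.exponent_dvd_of_forall_pow_eq_one hG)
    (orderOf_eq_prime_pow hg (hG g) ▸ Monoid.order_dvd_exponent g)

theorem prime_le_ncard_setOf_pow [Finite G] {e : ℕ} {g : G} (hg : g ^ p ^ e ≠ 1)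
    (hg' : g ^ p ^ (e + 1) = 1) : p ≤ {x : G | ∃ h : G, h ^ p ^ e = x}.ncard := by
  have hsub : (Subgroup.zpowers (g ^ p ^ e) : Set G) ⊆ {x : G | ∃ h : G, h ^ p ^ e = x} := by
    rintro _ ⟨k, rfl⟩
    exact ⟨g ^ k, by simp only [← zpow_natCast, zpow_comm g k]⟩
  calc p = orderOf (g ^ p ^ e) :=
        (orderOf_eq_prime (by rwa [← pow_mul, ← pow_succ]) hg).symm
    _ = (Subgroup.zpowers (g ^ p ^ e) : Set G).ncard := (Nat.card_zpowers _).symm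
    _ ≤ _ := Set.ncard_le_ncard hsub

end PrimePowerExponent

section LeadingDiagonal

variable {n : ℕ}

/-- The square matrix `M` vanishes below its `k`-th superdiagonal, whose entries, from top to
bottom, are `c 0, c 1, …`. The sequence `c` is indexed by `ℕ` so that it does not depend on the
length of the superdiagonal; its further values are irrelevant. -/
structure HasLeadingDiagonal {R : Type*} [Zero R] (k : ℕ) (c : ℕ → R)
    (M : Matrix (Fin n) (Fin n) R) : Prop where
  apply_eq_zero : ∀ i j : Fin n, (j : ℕ) < i + k → M i j = 0
  apply_eq : ∀ i j : Fin n, (j : ℕ) = i + k → M i j = c i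

namespace HasLeadingDiagonal

theorem exists_of_apply_eq_zero {R : Type*} [Zero R] {k : ℕ} {M : Matrix (Fin n) (Fin n) R}
    (hM : ∀ i j : Fin n, (j : ℕ) < i + k → M i j = 0) : ∃ c, HasLeadingDiagonal k c M := by
  refine ⟨fun i => if h : i + k < n then M ⟨i, by omega⟩ ⟨i + k, h⟩ else 0, hM, fun i j hij => ?_⟩
  have hik : (i : ℕ) + k < n := hij ▸ j.isLt
  rw [dif_pos hik]
  congr 1
  exact Fin.ext hij

theorem of_succ {R : Type*} [Zero R] {k : ℕ} {c : ℕ → R} {M : Matrix (Fin n) (Fin n) R}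
    (hM : HasLeadingDiagonal (k + 1) c M) : HasLeadingDiagonal k 0 M where
  apply_eq_zero i j hij := hM.apply_eq_zero i j (by omega)
  apply_eq i j hij := hM.apply_eq_zero i j (by omega)

theorem eq_zero {R : Type*} [Zero R] {k : ℕ} {c : ℕ → R} {M : Matrix (Fin n) (Fin n) R}
    (hM : HasLeadingDiagonal k c M) (hk : n ≤ k) : M = 0 := by
  ext i j
  exact hM.apply_eq_zero i j (by omega)

theorem eq_single {R : Type*} [Zero R] {k : ℕ} {c : ℕ → R}
    {M : Matrix (Fin (k + 1)) (Fin (k + 1)) R} (hM : HasLeadingDiagonal k c M) :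
    M = Matrix.single 0 (Fin.last k) (c 0) := by
  ext i j
  by_cases hij : 0 = i ∧ Fin.last k = j
  · obtain ⟨rfl, rfl⟩ := hij
    rw [Matrix.single_apply_same, hM.apply_eq _ _ (by simp), Fin.val_zero]
  · rw [Matrix.single_apply_of_ne _ _ _ _ _ hij]
    simp only [Fin.ext_iff, Fin.val_zero, Fin.val_last] at hij
    exact hM.apply_eq_zero i j (by omega)

variable {R : Type*}

theorem add [AddZeroClass R] {k : ℕ} {c d : ℕ → R} {M N : Matrix (Fin n) (Fin n) R}
    (hM : HasLeadingDiagonal k c M) (hN : HasLeadingDiagonal k d N) :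
    HasLeadingDiagonal k (c + d) (M + N) where
  apply_eq_zero i j hij := by
    rw [Matrix.add_apply, hM.apply_eq_zero i j hij, hN.apply_eq_zero i j hij, add_zero]
  apply_eq i j hij := by
    rw [Matrix.add_apply, hM.apply_eq i j hij, hN.apply_eq i j hij, Pi.add_apply]

theorem neg [NegZeroClass R] {k : ℕ} {c : ℕ → R} {M : Matrix (Fin n) (Fin n) R}
    (hM : HasLeadingDiagonal k c M) : HasLeadingDiagonal k (-c) (-M) where
  apply_eq_zero i j hij := by rw [Matrix.neg_apply, hM.apply_eq_zero i j hij, neg_zero]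
  apply_eq i j hij := by rw [Matrix.neg_apply, hM.apply_eq i j hij, Pi.neg_apply]

theorem mul [NonUnitalNonAssocSemiring R] {k l : ℕ} {c d : ℕ → R}
    {M N : Matrix (Fin n) (Fin n) R}
    (hM : HasLeadingDiagonal k c M) (hN : HasLeadingDiagonal l d N) :
    HasLeadingDiagonal (k + l) (fun i => c i * d (i + k)) (M * N) where
  apply_eq_zero i j hij := by
    rw [Matrix.mul_apply]
    refine Finset.sum_eq_zero fun m _ => ?_
    rcases lt_or_ge (m : ℕ) (i + k) with hm | hm
    · rw [hM.apply_eq_zero i m hm, zero_mul]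
    · rw [hN.apply_eq_zero m j (by omega), mul_zero]
  apply_eq i j hij := by
    let m₀ : Fin n := ⟨i + k, by omega⟩
    rw [Matrix.mul_apply, Finset.sum_eq_single m₀, hM.apply_eq i m₀ rfl,
      hN.apply_eq m₀ j (by simp only [m₀]; omega)]
    · intro m _ hm
      rcases lt_or_gt_of_ne (Fin.val_ne_of_ne hm) with hm | hm
      · rw [hM.apply_eq_zero i m hm, zero_mul]
      · rw [hN.apply_eq_zero m j (by simp only [m₀] at hm; omega), mul_zero]
    · exact fun h => absurd (Finset.mem_univ _) h

theorem one [Zero R] [One R] : HasLeadingDiagonal 0 1 (1 : Matrix (Fin n) (Fin n) R) where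
  apply_eq_zero i j hij := Matrix.one_apply_ne fun h => by omega
  apply_eq i j hij := by rw [Fin.ext hij.symm, Matrix.one_apply_eq, Pi.one_apply]

theorem pow [CommSemiring R] {c : ℕ → R} {M : Matrix (Fin n) (Fin n) R}
    (hM : HasLeadingDiagonal 1 c M) (k : ℕ) :
    HasLeadingDiagonal k (fun i => ∏ l ∈ Finset.range k, c (i + l)) (M ^ k) := by
  induction k with
  | zero =>
    simp only [pow_zero, Finset.range_zero, Finset.prod_empty]
    exact one
  | succ k ih => simpa only [pow_succ, Finset.prod_range_succ] using ih.mul hM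

end HasLeadingDiagonal

end LeadingDiagonal

section Unitriangular

variable {R : Type*} [CommRing R] {n : ℕ}

/-- `A` is upper unitriangular, and the entries just above its diagonal are `c 0, c 1, …`. -/
def IsUnitriangular (c : ℕ → R) (A : Matrix (Fin n) (Fin n) R) : Prop :=
  HasLeadingDiagonal 1 c (A - 1)

namespace IsUnitriangular

theorem one : IsUnitriangular 0 (1 : Matrix (Fin n) (Fin n) R) := by
  constructor <;> simp

theorem mul {c d : ℕ → R} {A B : Matrix (Fin n) (Fin n) R} (hA : IsUnitriangular c A)
    (hB : IsUnitriangular d B) : IsUnitriangular (c + d) (A * B) := by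
  have hAB : A * B - 1 = A - 1 + (B - 1) + (A - 1) * (B - 1) := by noncomm_ring
  rw [IsUnitriangular, hAB, ← add_zero (c + d)]
  exact (HasLeadingDiagonal.add hA hB).add (HasLeadingDiagonal.mul hA hB).of_succ

theorem blockTriangular {c : ℕ → R} {A : Matrix (Fin n) (Fin n) R} (hA : IsUnitriangular c A) :
    A.BlockTriangular id := fun i j hij => by
  have hji : j < i := hij
  have h := hA.apply_eq_zero i j (by omega)
  rwa [Matrix.sub_apply, Matrix.one_apply_ne hji.ne', sub_zero] at h

theorem exists_inv {c : ℕ → R} {A : (Matrix (Fin n) (Fin n) R)ˣ}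
    (hA : IsUnitriangular c A.val) : ∃ d, IsUnitriangular d (A⁻¹).val := by
  have hinv : ((A⁻¹).val).BlockTriangular id := by
    have := A.invertible
    rw [Matrix.coe_units_inv]
    exact Matrix.blockTriangular_inv_of_blockTriangular hA.blockTriangular
  obtain ⟨d, hd⟩ := HasLeadingDiagonal.exists_of_apply_eq_zero (k := 0) fun i j hij => hinv hij
  have hsub : (A⁻¹).val - 1 = -((A⁻¹).val * (A.val - 1)) := by
    rw [mul_sub, Units.inv_mul, mul_one, neg_sub]
  exact ⟨_, by simpa only [IsUnitriangular, hsub, zero_add] using (hd.mul hA).neg⟩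

theorem apply {c : ℕ → R} {A : Matrix (Fin n) (Fin n) R} (hA : IsUnitriangular c A)
    {i j : Fin n} (hij : (j : ℕ) = i + 1) : A i j = c i := by
  have hne : i ≠ j := fun h => by omega
  simpa only [Matrix.sub_apply, Matrix.one_apply_ne hne, sub_zero] using hA.apply_eq i j hij

theorem isUnit {c : ℕ → R} {A : Matrix (Fin n) (Fin n) R} (hA : IsUnitriangular c A) :
    IsUnit A := by
  have hnil : IsNilpotent (A - 1) := ⟨n, (HasLeadingDiagonal.pow hA n).eq_zero le_rfl⟩
  simpa only [sub_add_cancel] using hnil.isUnit_add_one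

variable {p : ℕ} [Fact p.Prime] [CharP R p]

theorem pow_char_pow_eq_one {c : ℕ → R} {A : Matrix (Fin (n + 1)) (Fin (n + 1)) R}
    (hA : IsUnitriangular c A) {k : ℕ} (hk : n < p ^ k) : A ^ p ^ k = 1 := by
  have h := (HasLeadingDiagonal.pow hA (p ^ k)).eq_zero hk
  rwa [sub_pow_char_pow_of_commute _ _ (Commute.one_right A), one_pow, sub_eq_zero] at h

theorem pow_char {c : ℕ → R} {A : Matrix (Fin (p + 1)) (Fin (p + 1)) R}
    (hA : IsUnitriangular c A) :
    A ^ p = 1 + Matrix.single 0 (Fin.last p) (∏ l ∈ Finset.range p, c l) := by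
  have h := (HasLeadingDiagonal.pow hA p).eq_single
  rw [sub_pow_char_of_commute _ (Commute.one_right A), one_pow, sub_eq_iff_eq_add'] at h
  simpa only [zero_add] using h

theorem pow_char_eq_one_iff {c : ℕ → R} {A : Matrix (Fin (p + 1)) (Fin (p + 1)) R}
    (hA : IsUnitriangular c A) : A ^ p = 1 ↔ ∏ l ∈ Finset.range p, c l = 0 := by
  rw [hA.pow_char, add_eq_left]
  refine ⟨fun h => ?_, fun h => by rw [h, Matrix.single_zero]⟩
  simpa only [Matrix.single_apply_same, Matrix.zero_apply] using
    congrFun₂ h 0 (Fin.last p)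

end IsUnitriangular

/-- The group of upper unitriangular `n × n` matrices over `R`. -/
def unitriangularGroup (n : ℕ) (R : Type*) [CommRing R] : Subgroup (Matrix (Fin n) (Fin n) R)ˣ where
  carrier := {A | ∃ c, IsUnitriangular c A.val}
  mul_mem' := fun ⟨_, hA⟩ ⟨_, hB⟩ => ⟨_, hA.mul hB⟩
  one_mem' := ⟨0, IsUnitriangular.one⟩
  inv_mem' := fun ⟨_, hA⟩ => hA.exists_inv

theorem exists_isUnitriangular (n : ℕ) (c : ℕ → R) :
    ∃ A : unitriangularGroup n R, IsUnitriangular c A.1.val := by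
  let N : Matrix (Fin n) (Fin n) R := .of fun i j => if (j : ℕ) = i + 1 then c i else 0
  have hN : IsUnitriangular c (N + 1) := by
    rw [IsUnitriangular, add_sub_cancel_right]
    exact ⟨fun i j hij => if_neg (by omega), fun i j hij => if_pos hij⟩
  exact ⟨⟨hN.isUnit.unit, c, hN⟩, hN⟩

/-- The homomorphism reading off the entries just above the diagonal. -/
def superdiagHom : unitriangularGroup (n + 1) R →* Multiplicative (Fin n → R) :=
  MonoidHom.mk' (fun A => .ofAdd fun i => A.1.val i.castSucc i.succ) <| by
    rintro ⟨A, c, hA⟩ ⟨B, d, hB⟩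
    refine congrArg Multiplicative.ofAdd (funext fun i => ?_)
    have hi : (i.succ : ℕ) = i.castSucc + 1 := by simp
    exact ((hA.mul hB).apply hi).trans (congrArg₂ _ (hA.apply hi) (hB.apply hi)).symm

theorem superdiagHom_apply {c : ℕ → R} {A : unitriangularGroup (n + 1) R}
    (hA : IsUnitriangular c A.1.val) : superdiagHom A = .ofAdd fun i : Fin n => c i :=
  congrArg Multiplicative.ofAdd (funext fun i => hA.apply (by simp))

variable {p : ℕ} [Fact p.Prime] [CharP R p]

theorem unitriangularGroup_pow_char_pow_eq_one (A : unitriangularGroup (n + 1) R) {k : ℕ}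
    (hk : n < p ^ k) : A ^ p ^ k = 1 := by
  obtain ⟨A, c, hA⟩ := A
  exact Subtype.ext (Units.ext (by simpa using hA.pow_char_pow_eq_one hk))

theorem unitriangularGroup_pow_char_eq_one_iff {c : ℕ → R} {A : unitriangularGroup (p + 1) R}
    (hA : IsUnitriangular c A.1.val) : A ^ p = 1 ↔ ∏ l ∈ Finset.range p, c l = 0 := by
  rw [← hA.pow_char_eq_one_iff, Subtype.ext_iff, Units.ext_iff]
  simp

theorem isPGroup_unitriangularGroup : IsPGroup p (unitriangularGroup (n + 1) R) := fun A =>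
  ⟨n, unitriangularGroup_pow_char_pow_eq_one A (Nat.lt_pow_self (Fact.out : p.Prime).one_lt)⟩

theorem ncard_setOf_pow_char_le [Finite R] (G : Subgroup (unitriangularGroup (p + 1) R)) :
    {x : G | ∃ g : G, g ^ p = x}.ncard ≤ Nat.card R := by
  let corner (x : G) : R := x.1.1.val 0 (Fin.last p)
  have val_pow (g : G) : ∃ d : R, (g ^ p).1.1.val = 1 + Matrix.single 0 (Fin.last p) d := by
    obtain ⟨c, hA⟩ := g.1.2
    exact ⟨_, hA.pow_char⟩
  have corner_injOn : Set.InjOn corner {x : G | ∃ g : G, g ^ p = x} := by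
    rintro _ ⟨g, rfl⟩ _ ⟨h, rfl⟩ hgh
    obtain ⟨d, hd⟩ := val_pow g
    obtain ⟨d', hd'⟩ := val_pow h
    have hdd' : d = d' := by simpa only [corner, hd, hd', Matrix.add_apply,
      Matrix.single_apply_same, add_right_inj] using hgh
    exact Subtype.ext (Subtype.ext (Units.ext (by rw [hd, hd', hdd'])))
  calc _ ≤ (Set.univ : Set R).ncard :=
        Set.ncard_le_ncard_of_injOn corner (fun _ _ => Set.mem_univ _) corner_injOn
    _ = Nat.card R := Set.ncard_univ R

end Unitriangular

section Pencil

variable {R : Type*} [CommRing R]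

/-- The superdiagonal `s, t, s - t, s, s, …`. It is linear in `(s, t)`, and the product of its
entries vanishes for `(s, t) = (1, 0), (0, 1), (1, 1)` but, in odd characteristic, not for
`(2, 1)`. -/
def pencil (s t : R) : ℕ → R
  | 0 => s
  | 1 => t
  | 2 => s - t
  | _ => s

theorem pencil_add (s t s' t' : R) : pencil s t + pencil s' t' = pencil (s + s') (t + t') := by
  funext i
  match i with
  | 0 | 1 | _ + 3 => rfl
  | 2 => exact (add_sub_add_comm s s' t t').symm

theorem prod_pencil (s t : R) (n : ℕ) :
    ∏ l ∈ Finset.range (n + 3), pencil s t l = s ^ n * (s - t) * t * s := by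
  simp [Finset.prod_range_succ', pencil]

theorem prod_pencil_eq_zero_iff [IsDomain R] {n : ℕ} (hn : 3 ≤ n) (s t : R) :
    ∏ l ∈ Finset.range n, pencil s t l = 0 ↔ s = 0 ∨ t = 0 ∨ s = t := by
  obtain ⟨m, rfl⟩ := Nat.exists_eq_add_of_le' hn
  rw [prod_pencil]
  simp only [mul_eq_zero, pow_eq_zero_iff', sub_eq_zero]
  tauto

theorem linearIndependent_pencil {n : ℕ} (hn : 2 ≤ n) :
    LinearIndependent R
      ![fun i : Fin n => pencil (1 : R) 0 i, fun i : Fin n => pencil (0 : R) 1 i] := by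
  refine LinearIndependent.pair_iff.2 fun a b hab => ⟨?_, ?_⟩
  · simpa [pencil] using congrFun hab ⟨0, by omega⟩
  · simpa [pencil] using congrFun hab ⟨1, by omega⟩

theorem exists_pencil_generators {p : ℕ} [Fact p.Prime] (hp3 : 3 ≤ p) [CharP R p] [IsDomain R] :
    ∃ x y : unitriangularGroup (p + 1) R, (∀ s ∈ ({x, y, x * y} : Set _), s ^ p = 1) ∧
      (x * (x * y)) ^ p ≠ 1 ∧
        LinearIndependent R ![(superdiagHom x).toAdd, (superdiagHom y).toAdd] := by
  obtain ⟨x, hx⟩ := exists_isUnitriangular (p + 1) (pencil (1 : R) 0)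
  obtain ⟨y, hy⟩ := exists_isUnitriangular (p + 1) (pencil (0 : R) 1)
  have hxy : IsUnitriangular (pencil 1 1) (x * y).1.val := by
    simpa only [pencil_add, add_zero, zero_add, ← Units.val_mul, ← Subgroup.coe_mul] using hx.mul hy
  have hxxy : IsUnitriangular (pencil 2 1) (x * (x * y)).1.val := by
    simpa only [pencil_add, one_add_one_eq_two, zero_add, ← Units.val_mul, ← Subgroup.coe_mul]
      using hx.mul hxy
  have pow_eq_one_iff {s t : R} {A : unitriangularGroup (p + 1) R}
      (hA : IsUnitriangular (pencil s t) A.1.val) : A ^ p = 1 ↔ s = 0 ∨ t = 0 ∨ s = t :=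
    (unitriangularGroup_pow_char_eq_one_iff hA).trans (prod_pencil_eq_zero_iff hp3 s t)
  refine ⟨x, y, ?_, ?_, ?_⟩
  · rintro s (rfl | rfl | rfl)
    exacts [(pow_eq_one_iff hx).2 (by simp), (pow_eq_one_iff hy).2 (by simp),
      (pow_eq_one_iff hxy).2 (by simp)]
  · have h2 : (2 : R) ≠ 0 := Ring.two_ne_zero (by rw [ringChar.eq R p]; omega)
    rw [ne_eq, pow_eq_one_iff hxxy]
    rintro (h | h | h)
    exacts [h2 h, one_ne_zero h, one_ne_zero (by linear_combination h)]
  · rw [superdiagHom_apply hx, superdiagHom_apply hy]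
    exact linearIndependent_pencil (by omega)

end Pencil

theorem mainTheorem7 (p : ℕ) (hp : p.Prime) (hp5 : 5 ≤ p) :
    ∃ (G : Type) (_ : Group G) (_ : Finite G), IsPGroup p G ∧
      (∃ e : ℕ, 1 ≤ e ∧ Monoid.exponent G = p ^ e ∧
        {x : G | ∃ g : G, g ^ p ^ (e - 1) = x}.ncard = p) ∧
      ∀ r₁ r₂ : ℕ, 3 ≤ r₁ → 3 ≤ r₂ → (r₁, r₂) ∈ ramificationSizes G := by
  have : Fact p.Prime := ⟨hp⟩
  obtain ⟨x, y, hpow, hxxy, hindep⟩ :=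
    exists_pencil_generators (R := ZMod p) (p := p) (by omega)
  let G : Subgroup (unitriangularGroup (p + 1) (ZMod p)) := Subgroup.closure {x, y}
  have hx : x ∈ G := Subgroup.subset_closure (by simp)
  have hy : y ∈ G := Subgroup.subset_closure (by simp)
  have hG (g : G) : g ^ p ^ 2 = 1 :=
    Subtype.ext (unitriangularGroup_pow_char_pow_eq_one g.1 (lt_self_pow₀ (by omega) one_lt_two))
  let z : G := ⟨x * (x * y), mul_mem hx (mul_mem hx hy)⟩
  have hz : z ^ p ^ 1 ≠ 1 := by rwa [pow_one, ne_eq, Subtype.ext_iff]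
  refine ⟨G, inferInstance, inferInstance, isPGroup_unitriangularGroup.to_subgroup G,
    ⟨2, one_le_two, exponent_eq_prime_pow hG hz,
      le_antisymm ?_ (prime_le_ncard_setOf_pow hz (hG z))⟩,
    fun r₁ r₂ => mem_ramificationSizes_closure_pair (by omega) (by omega) hpow superdiagHom hindep⟩
  simpa using ncard_setOf_pow_char_le G
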